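/- Let $k$ be a field, $n\ge 0$, and for a $k$-algebra $A$ let $S_{A,d}$ be the $A$-module of homogeneous polynomials of degree $d$ in $A[x_0,\dots,x_n]$ (with $S_{A,-1}=0$). Let $p$ be the Hilbert polynomial of a closed subscheme of $\mathbb{P}^n_k$, let $r$ be its Gotzmann number, i.e. the number of binomials in the expression $p(d)=\sum_{i=0}^{r-1}\binom{d+a_i-i}{a_i}$ with $a_0\ge\dots\ge a_{r-1}\ge 0$, and let $R\ge r$. Let $Q_p$ be the quiver with four vertices and $2n+3$ arrows: $\mu_0,\dots,\mu_n$ from the first vertex to the second, $\rho$ from the second to the third, and $M_0,\dots,M_n$ from the third to the fourth. For a $k$-algebra $A$ let $\mathbf{C}^p(A)$ be the set of representations $(\mu,\rho,M)$ of $Q_p$ on the $A$-modules $S_{A,R-1},\ S_{A,R},\ A^{p(R)},\ A^{p(R+1)}$ such that 1. $\mu_i: S_{A,R-1}\to S_{A,R}$ is multiplication by $x_i$ for $0\le i\le n$; 2. $\rho: S_{A,R}\to A^{p(R)}$ is surjective; 3. $\Sigma M:(A^{p(R)})^{n+1}\to A^{p(R+1)}$, $(e_0,\dots,e_n)\mapsto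 \sum_i M_i(e_i)$, is surjective; 4. $M_i\circ\rho\circ\mu_j=M_j\circ\rho\circ\mu_i$ for all $0\le i,j\le n$. With base change $(\rho,M)\mapsto(\rho\otimes_A B,M\otimes_A B)$ along $k$-algebra maps $A\to B$, $\mathbf{C}^p$ is a functor from $k$-algebras to sets. **Proposition.** There is a $k$-scheme $C^p$ with an isomorphism $\mathrm{Hom}_k(\mathrm{Spec}\,A,C^p)\cong\mathbf{C}^p(A)$, functorial in the $k$-algebra $A$. The scheme $C^p$ is a locally closed subscheme of the affine space over $k$ of all tuples of matrices $(\rho,M_0,\dots,M_n)$: there is an immersion over $k$ of $C^p$ into this space that sends each $A$-point to the point given by the entries of its matrices (with respect to the monomials of $S_{A,R}$ and the standard bases). The $k$-points of $C^p$ are representations of $Q_p$: the isomorphism for $A=k$ identifies them with the representations of $Q_p$ on the vector spaces $S_{k,R-1},\ S_{k,R},\ k^{p(R)},\ k^{p(R+1)}$ that satisfy 1–4, and these representations have dimension vector $\left(\binom{R-1+n}{R-1},\binom{R+n}{R},p(R),p(R+1)\right)$ (first entry $0$ if $R=0$). -/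

import Mathlib

open CategoryTheory AlgebraicGeometry

universe u

namespace HilbertQuiver

noncomputable section

/-! ### Homogeneous polynomials, Hilbert polynomials and Gotzmann numbers -/

/-- `S_{A,d}`: the `A`-submodule of `A[x_0, …, x_n]` of homogeneous polynomials of degree `d`.
The degree is an integer, so that `S_{A,-1} = 0`. -/
def gradedPiece (A : Type u) [CommRing A] (n : ℕ) (d : ℤ) :
    Submodule A (MvPolynomial (Fin (n + 1)) A) :=
  MvPolynomial.restrictSupport A {m | (m.degree : ℤ) = d}

/-- The Hilbert function `d ↦ dim_k (S_d / I_d)` of the subscheme of `ℙ^n` cut out by a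
homogeneous ideal `I` of `S = k[x_0, …, x_n]`. -/
def hilbertFunction {k : Type u} [Field k] {n : ℕ} (I : Ideal (MvPolynomial (Fin (n + 1)) k))
    (d : ℕ) : ℕ :=
  Module.finrank k (gradedPiece k n d ⧸
    (I.restrictScalars k).comap (gradedPiece k n d).subtype)

/-- `p` is the Hilbert polynomial of a closed subscheme of `ℙ^n` over `k`. The closed subschemes
are those cut out by homogeneous ideals, and the Hilbert polynomial is the polynomial that agrees
with the Hilbert function in all large degrees. -/
def IsHilbertPolynomial (k : Type u) [Field k] (n : ℕ) (p : Polynomial ℚ) : Prop :=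
  ∃ I : Ideal (MvPolynomial (Fin (n + 1)) k),
    (∀ f ∈ I, ∀ d : ℕ, MvPolynomial.homogeneousComponent d f ∈ I) ∧
      ∀ᶠ d : ℕ in Filter.atTop, p.eval (d : ℚ) = hilbertFunction I d

/-- `r` is the Gotzmann number of `p`, that is, the number of binomials in the expression
`p(d) = ∑_{0 ≤ i < r} (d + a_i - i choose a_i)` with `a_0 ≥ a_1 ≥ … ≥ a_{r-1} ≥ 0`. Here
`Polynomial.preHilbertPoly ℚ a i` is the polynomial `d ↦ (d + a - i choose a)`. -/
def IsGotzmannNumber (p : Polynomial ℚ) (r : ℕ) : Prop :=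
  ∃ a : Fin r → ℕ, Antitone a ∧ p = ∑ i : Fin r, Polynomial.preHilbertPoly ℚ (a i) i

/-! ### The quiver -/

/-- The four vertices of the quiver `Q_p`. -/
inductive Vertex (n : ℕ) : Type
  | one
  | two
  | three
  | four

/-- The `2n + 3` arrows of the quiver `Q_p`: `μ_0, …, μ_n` from the first vertex to the second,
`ρ` from the second to the third, and `M_0, …, M_n` from the third to the fourth. -/
inductive Arrow (n : ℕ) : Vertex n → Vertex n → Type
  | mu (i : Fin (n + 1)) : Arrow n .one .two
  | rho : Arrow n .two .three
  | M (i : Fin (n + 1)) : Arrow n .three .four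

instance (n : ℕ) : Quiver (Vertex n) := ⟨Arrow n⟩

/-- The representations of the quiver `Q_p` over `A`: a module at each vertex and a linear map
along each arrow. -/
abbrev QuiverRep (A : Type u) [CommRing A] (n : ℕ) := Vertex n ⥤q ModuleCat.{u} A

/-- The dimension vector `(R-1+n choose R-1, R+n choose R, a, b)`, whose first entry is `0`
for `R = 0`. -/
def dimVector (n R a b : ℕ) : Vertex n → ℕ
  | .one => match R with
    | 0 => 0
    | R' + 1 => (R' + n).choose R'
  | .two => (R + n).choose R
  | .three => a
  | .four => b

/-- The modules `S_{A,R-1}`, `S_{A,R}`, `A^a`, `A^b` at the vertices. -/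
def vertexSpace (n R a b : ℕ) (A : Type u) [CommRing A] : Vertex n → ModuleCat.{u} A
  | .one => ModuleCat.of A (gradedPiece A n ((R : ℤ) - 1))
  | .two => ModuleCat.of A (gradedPiece A n R)
  | .three => ModuleCat.of A (Fin a → A)
  | .four => ModuleCat.of A (Fin b → A)

/-- The representations of `Q_p` over `A` with the modules `S_{A,R-1}`, `S_{A,R}`, `A^a`, `A^b`
at the vertices: a linear map along each arrow. -/
def Rep (n R a b : ℕ) (A : Type u) [CommRing A] : Type u :=
  ∀ v w : Vertex n, (v ⟶ w) → (vertexSpace n R a b A v →ₗ[A] vertexSpace n R a b A w)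

namespace Rep

variable {n R a b : ℕ} {A : Type u} [CommRing A]

/-- The map `μ_i : S_{A,R-1} → S_{A,R}`. -/
def mu (φ : Rep n R a b A) (i : Fin (n + 1)) :
    gradedPiece A n ((R : ℤ) - 1) →ₗ[A] gradedPiece A n R :=
  φ .one .two (.mu i)

/-- The map `ρ : S_{A,R} → A^a`. -/
def rho (φ : Rep n R a b A) : gradedPiece A n R →ₗ[A] (Fin a → A) :=
  φ .two .three .rho

/-- The map `M_i : A^a → A^b`. -/
def M (φ : Rep n R a b A) (i : Fin (n + 1)) : (Fin a → A) →ₗ[A] (Fin b → A) :=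
  φ .three .four (.M i)

/-- The map `ΣM : (A^a)^{n+1} → A^b`, `(e_0, …, e_n) ↦ M_0 e_0 + … + M_n e_n`. -/
def sumM (φ : Rep n R a b A) : (Fin (n + 1) → Fin a → A) →ₗ[A] (Fin b → A) :=
  ∑ i, φ.M i ∘ₗ LinearMap.proj i

/-- The underlying representation of the quiver. -/
def toQuiverRep (φ : Rep n R a b A) : QuiverRep A n where
  obj := vertexSpace n R a b A
  map {v w} e := ModuleCat.ofHom (φ v w e)

/-- The conditions that define `C^p`. -/
structure IsAdmissible (φ : Rep n R a b A) : Prop where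
  /-- `μ_i` is the multiplication by `x_i`. -/
  mu_apply : ∀ (i : Fin (n + 1)) (f : gradedPiece A n ((R : ℤ) - 1)),
    (φ.mu i f : MvPolynomial (Fin (n + 1)) A) = MvPolynomial.X i * (f : MvPolynomial (Fin (n + 1)) A)
  surjective_sumM : Function.Surjective φ.sumM
  surjective_rho : Function.Surjective φ.rho
  comm : ∀ i j : Fin (n + 1), φ.M i ∘ₗ φ.rho ∘ₗ φ.mu j = φ.M j ∘ₗ φ.rho ∘ₗ φ.mu i

end Rep

/-! ### Base change -/

section BaseChange

variable (n R a b : ℕ)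

/-- The index set of the standard basis at each vertex: the monomials of degree `R - 1` and `R`,
and the standard bases of `A^a` and `A^b`. -/
def VertexIndex : Vertex n → Type
  | .one => {m : Fin (n + 1) →₀ ℕ | (m.degree : ℤ) = (R : ℤ) - 1}
  | .two => {m : Fin (n + 1) →₀ ℕ | (m.degree : ℤ) = (R : ℤ)}
  | .three => Fin a
  | .four => Fin b

/-- The basis of `S_{A,d}` that consists of the monomials of degree `d`. -/
def gradedPieceBasis (A : Type u) [CommRing A] (d : ℤ) :
    Module.Basis {m : Fin (n + 1) →₀ ℕ | (m.degree : ℤ) = d} A (gradedPiece A n d) :=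
  MvPolynomial.basisRestrictSupport A _

/-- The standard basis of the module at each vertex. -/
def vertexBasis (A : Type u) [CommRing A] :
    ∀ v : Vertex n, Module.Basis (VertexIndex n R a b v) A (vertexSpace n R a b A v)
  | .one => gradedPieceBasis n A _
  | .two => gradedPieceBasis n A _
  | .three => Pi.basisFun A (Fin a)
  | .four => Pi.basisFun A (Fin b)

variable {A B : Type u} [CommRing A] [CommRing B] (f : A →+* B)

/-- The map `S_{A,d} → S_{B,d}` which applies `f` to the coefficients. -/
def gradedPieceMap (d : ℤ) : gradedPiece A n d →ₛₗ[f] gradedPiece B n d where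
  toFun g := ⟨MvPolynomial.map f g.1, fun _ hm =>
    g.2 (MvPolynomial.support_map_subset f g.1 hm)⟩
  map_add' g h := Subtype.ext (map_add (MvPolynomial.map f) g.1 h.1)
  map_smul' c g := Subtype.ext (by
    simp [MvPolynomial.smul_eq_C_mul])

/-- The map `A^c → B^c` which applies `f` to the coordinates. -/
def piMap (c : ℕ) : (Fin c → A) →ₛₗ[f] (Fin c → B) where
  toFun x i := f (x i)
  map_add' x y := by ext i; simp
  map_smul' c x := by ext i; simp

/-- The canonical map from the module at a vertex over `A` to the one over `B`. It identifies the
latter with the base change of the former, see `vertexMap_basis`. -/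
def vertexMap : ∀ v : Vertex n, vertexSpace n R a b A v →ₛₗ[f] vertexSpace n R a b B v
  | .one => gradedPieceMap n f _
  | .two => gradedPieceMap n f _
  | .three => piMap f a
  | .four => piMap f b

lemma gradedPieceBasis_coe (A : Type u) [CommRing A] (d : ℤ)
    (m : {m : Fin (n + 1) →₀ ℕ | (m.degree : ℤ) = d}) :
    (gradedPieceBasis n A d m : MvPolynomial (Fin (n + 1)) A) = MvPolynomial.monomial m.1 1 := by
  have h : gradedPieceBasis n A d m = ⟨MvPolynomial.monomial m.1 1,
      (MvPolynomial.monomial_mem_restrictSupport A).2 (Or.inl m.2)⟩ := by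
    rw [Module.Basis.apply_eq_iff]
    ext m'
    change MvPolynomial.coeff m'.1 (MvPolynomial.monomial m.1 (1 : A)) = _
    classical
    rw [MvPolynomial.coeff_monomial, Finsupp.single_apply]
    simp only [Subtype.ext_iff]
  rw [h]

lemma gradedPieceMap_basis (d : ℤ) (m : {m : Fin (n + 1) →₀ ℕ | (m.degree : ℤ) = d}) :
    gradedPieceMap n f d (gradedPieceBasis n A d m) = gradedPieceBasis n B d m := by
  apply Subtype.ext
  change MvPolynomial.map f (gradedPieceBasis n A d m).1 = _
  rw [gradedPieceBasis_coe, gradedPieceBasis_coe, MvPolynomial.map_monomial, map_one]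

lemma piMap_basis (c : ℕ) (i : Fin c) :
    piMap f c (Pi.basisFun A (Fin c) i) = Pi.basisFun B (Fin c) i := by
  ext j
  change f (Pi.basisFun A (Fin c) i j) = Pi.basisFun B (Fin c) i j
  simp [Pi.basisFun_apply, Pi.single_apply, apply_ite f]

lemma vertexMap_basis (v : Vertex n) (i : VertexIndex n R a b v) :
    vertexMap n R a b f v (vertexBasis n R a b A v i) = vertexBasis n R a b B v i := by
  cases v with
  | one => exact gradedPieceMap_basis n f _ i
  | two => exact gradedPieceMap_basis n f _ i
  | three => exact piMap_basis f a i
  | four => exact piMap_basis f b i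

variable {n R a b}

/-- The base change `φ ⊗_A B` of a representation along `f : A → B`: the `B`-linear maps with
the same values on the standard bases, see `baseChange_apply`. -/
def Rep.baseChange (φ : Rep n R a b A) : Rep n R a b B := fun v w e =>
  (vertexBasis n R a b B v).constr ℕ fun i =>
    vertexMap n R a b f w (φ v w e (vertexBasis n R a b A v i))

/-- `(φ ⊗_A B)(x ⊗ 1) = φ(x) ⊗ 1`. -/
lemma Rep.baseChange_apply (φ : Rep n R a b A) {v w : Vertex n} (e : v ⟶ w)
    (x : vertexSpace n R a b A v) :
    φ.baseChange f v w e (vertexMap n R a b f v x) = vertexMap n R a b f w (φ v w e x) := by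
  have key : ((φ.baseChange f v w e).comp (vertexMap n R a b f v) :
      vertexSpace n R a b A v →ₛₗ[f] vertexSpace n R a b B w) =
      (vertexMap n R a b f w).comp (φ v w e) := by
    refine (vertexBasis n R a b A v).ext fun i => ?_
    simp only [LinearMap.comp_apply, vertexMap_basis]
    exact (vertexBasis n R a b B v).constr_basis ℕ _ i
  exact LinearMap.congr_fun key x

/-- The base change is the only representation with the property in `baseChange_apply`. -/
lemma Rep.eq_baseChange (φ : Rep n R a b A) (ψ : Rep n R a b B)
    (h : ∀ (v w : Vertex n) (e : v ⟶ w) (x : vertexSpace n R a b A v),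
      ψ v w e (vertexMap n R a b f v x) = vertexMap n R a b f w (φ v w e x)) :
    ψ = φ.baseChange f := by
  funext v w e
  refine (vertexBasis n R a b B v).ext fun i => ?_
  rw [← vertexMap_basis (f := f), h, Rep.baseChange_apply]

lemma vertexMap_id (v : Vertex n) (x : vertexSpace n R a b A v) :
    vertexMap n R a b (RingHom.id A) v x = x := by
  cases v with
  | one => exact Subtype.ext (MvPolynomial.map_id x.1)
  | two => exact Subtype.ext (MvPolynomial.map_id x.1)
  | three => rfl
  | four => rfl

lemma vertexMap_comp {C : Type u} [CommRing C] (g : B →+* C) (v : Vertex n)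
    (x : vertexSpace n R a b A v) :
    vertexMap n R a b (g.comp f) v x = vertexMap n R a b g v (vertexMap n R a b f v x) := by
  cases v with
  | one => exact Subtype.ext (MvPolynomial.map_map f g x.1).symm
  | two => exact Subtype.ext (MvPolynomial.map_map f g x.1).symm
  | three => rfl
  | four => rfl

lemma Rep.baseChange_id (φ : Rep n R a b A) : φ.baseChange (RingHom.id A) = φ := by
  refine (Rep.eq_baseChange (RingHom.id A) φ φ fun v w e x => ?_).symm
  rw [vertexMap_id, vertexMap_id]

lemma Rep.baseChange_comp {C : Type u} [CommRing C] (g : B →+* C) (φ : Rep n R a b A) :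
    φ.baseChange (g.comp f) = (φ.baseChange f).baseChange g := by
  refine (Rep.eq_baseChange (g.comp f) φ _ fun v w e x => ?_).symm
  rw [vertexMap_comp, vertexMap_comp, Rep.baseChange_apply, Rep.baseChange_apply]

lemma Rep.IsAdmissible.baseChange {φ : Rep n R a b A} (h : φ.IsAdmissible) :
    (φ.baseChange f).IsAdmissible := by
  have hb (v w : Vertex n) (e : v ⟶ w) (x : vertexSpace n R a b A v) := φ.baseChange_apply f e x
  have hmu (i : Fin (n + 1)) (x : gradedPiece A n ((R : ℤ) - 1)) :
      (φ.baseChange f).mu i (gradedPieceMap n f _ x) = gradedPieceMap n f _ (φ.mu i x) :=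
    hb .one .two (.mu i) x
  have hrho (x : gradedPiece A n R) :
      (φ.baseChange f).rho (gradedPieceMap n f _ x) = piMap f a (φ.rho x) :=
    hb .two .three .rho x
  have hM (i : Fin (n + 1)) (x : Fin a → A) :
      (φ.baseChange f).M i (piMap f a x) = piMap f b (φ.M i x) :=
    hb .three .four (.M i) x
  refine ⟨fun i g => ?_, ?_, ?_, fun i j => ?_⟩
  · have key : (gradedPiece B n R).subtype ∘ₗ (φ.baseChange f).mu i =
        LinearMap.mulLeft B (MvPolynomial.X i) ∘ₗ (gradedPiece B n ((R : ℤ) - 1)).subtype := by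
      refine (gradedPieceBasis n B _).ext fun m => ?_
      rw [← gradedPieceMap_basis n f]
      simp only [LinearMap.comp_apply, hmu, Submodule.subtype_apply, LinearMap.mulLeft_apply]
      change MvPolynomial.map f (φ.mu i _).1 = MvPolynomial.X i * MvPolynomial.map f _
      rw [h.mu_apply, map_mul, MvPolynomial.map_X]
    exact LinearMap.congr_fun key g
  · rw [← LinearMap.range_eq_top, eq_top_iff, ← (Pi.basisFun B (Fin b)).span_eq,
      Submodule.span_le]
    rintro _ ⟨i, rfl⟩
    obtain ⟨x, hx⟩ := h.surjective_sumM (Pi.basisFun A (Fin b) i)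
    refine ⟨fun l => piMap f a (x l), ?_⟩
    rw [← piMap_basis f, ← hx]
    simp only [Rep.sumM, LinearMap.sum_apply, LinearMap.comp_apply, LinearMap.proj_apply, hM,
      map_sum]
  · rw [← LinearMap.range_eq_top, eq_top_iff, ← (Pi.basisFun B (Fin a)).span_eq,
      Submodule.span_le]
    rintro _ ⟨i, rfl⟩
    obtain ⟨x, hx⟩ := h.surjective_rho (Pi.basisFun A (Fin a) i)
    exact ⟨gradedPieceMap n f _ x, by rw [hrho, hx, piMap_basis]⟩
  · refine (gradedPieceBasis n B _).ext fun m => ?_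
    rw [← gradedPieceMap_basis n f]
    simp only [LinearMap.comp_apply, hmu, hrho, hM]
    exact congrArg (piMap f b) (LinearMap.congr_fun (h.comm i j) _)

end BaseChange

/-! ### The functor `C^p` -/

/-- The value of the functor `C^p` at `A`: the tuples `(μ, ρ, M)` that satisfy the conditions. -/
def CpPoint (n R a b : ℕ) (A : Type u) [CommRing A] : Type u :=
  {φ : Rep n R a b A // φ.IsAdmissible}

/-- The functor `C^p` from `k`-algebras to sets. -/
def CpFunctor (k : Type u) [Field k] (n R a b : ℕ) : CommAlgCat.{u} k ⥤ Type u where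
  obj A := CpPoint n R a b A
  map {A B} f := ↾fun φ => ⟨φ.1.baseChange (f.hom : A →+* B), φ.2.baseChange (f.hom : A →+* B)⟩
  map_id A := by
    ext φ
    exact Subtype.ext (Rep.baseChange_id φ.1)
  map_comp {A B C} f g := by
    ext φ
    exact Subtype.ext (Rep.baseChange_comp (f.hom : A →+* B) (g.hom : B →+* C) φ.1)

/-- The functor of points `A ↦ Hom_k(Spec A, X)` of a `k`-scheme `X`, on `k`-algebras. -/
def pointFunctor (k : Type u) [Field k] (X : Over (Spec (CommRingCat.of k))) :
    CommAlgCat.{u} k ⥤ Type u :=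
  (algSpec (CommRingCat.of k)).rightOp ⋙ yoneda.obj X

/-! ### The affine space of matrices -/

/-- The matrix entries of a pair `(ρ, M)`: a row and a column (a monomial of degree `R`) for `ρ`,
an index `i`, a row and a column for `M_i`. -/
abbrev Entry (n R a b : ℕ) : Type :=
  (Fin a × {m : Fin (n + 1) →₀ ℕ // (m.degree : ℤ) = R}) ⊕ (Fin (n + 1) × Fin b × Fin a)

/-- The entries of the matrices of `ρ, M_0, …, M_n` in the standard bases. -/
def Rep.entry {n R a b : ℕ} {A : Type u} [CommRing A] (φ : Rep n R a b A) :
    Entry n R a b → A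
  | .inl (i, m) => φ.rho ⟨MvPolynomial.monomial m.1 1,
      (MvPolynomial.monomial_mem_restrictSupport A).2 (Or.inl m.2)⟩ i
  | .inr (l, i, j) => φ.M l (Pi.single j 1) i

/-- The algebra of polynomials in the matrix entries. -/
abbrev entryAlgebra (k : Type u) [Field k] (n R a b : ℕ) : CommAlgCat.{u} k :=
  CommAlgCat.of k (MvPolynomial (Entry n R a b) k)

/-- The affine space over `k` of all tuples of matrices `(ρ, M_0, …, M_n)`. -/
def matrixSpace (k : Type u) [Field k] (n R a b : ℕ) : Over (Spec (CommRingCat.of k)) :=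
  (algSpec (CommRingCat.of k)).obj (Opposite.op (entryAlgebra k n R a b))

/-- The `A`-point of the affine space of matrices with prescribed entries. -/
def matrixPoint {k : Type u} [Field k] {n R a b : ℕ} (A : CommAlgCat.{u} k)
    (c : Entry n R a b → A) :
    (algSpec (CommRingCat.of k)).obj (Opposite.op A) ⟶ matrixSpace k n R a b :=
  (algSpec (CommRingCat.of k)).map
    (CommAlgCat.ofHom (MvPolynomial.aeval c) : entryAlgebra k n R a b ⟶ A).op

end

end HilbertQuiver

/-!
In coordinates, a representation whose maps `μ_i` are the multiplications by the variables is a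
tuple of matrices `(ρ, M_0, …, M_n)`. The relations `M_i ∘ ρ ∘ μ_j = M_j ∘ ρ ∘ μ_i` are polynomial
equations in the entries; they generate an ideal `I`. A matrix is surjective if and only if its
maximal minors generate the unit ideal: expand the determinant of `N * K` for a right inverse `K`,
and conversely combine the adjugates of the minors to a right inverse. Let `J` be generated by the
products of a maximal minor of `ρ` and one of `ΣM`. Both ideals are compatible with base change, so
the `A`-points of `C^p = V(I) ∩ D(J)` are the tuples for which `I` becomes zero and `J` becomes the
unit ideal in `A`, that is, the representations that satisfy the conditions.
-/

namespace HilbertQuiver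

noncomputable section

section MaximalMinors

variable {m ι A B : Type*} [Fintype m] [DecidableEq m] [CommRing A] [CommRing B]

/-- The ideal generated by the maximal minors of an `m × ι` matrix. The column indices of a minor
form an arbitrary family `g : m → ι`; if `g` is not injective, the minor is zero. -/
def maximalMinorIdeal (N : Matrix m ι A) : Ideal A :=
  Ideal.span (Set.range fun g : m → ι => (N.submatrix id g).det)

lemma map_maximalMinorIdeal (f : A →+* B) (N : Matrix m ι A) :
    (maximalMinorIdeal N).map f = maximalMinorIdeal (N.map f) := by
  rw [maximalMinorIdeal, Ideal.map_span, ← Set.range_comp]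
  refine congrArg (fun v => Ideal.span (Set.range v)) (funext fun g => ?_)
  exact RingHom.map_det f _

lemma det_mul_eq_sum_prod_mul_det [Fintype ι] (N : Matrix m ι A) (K : Matrix ι m A) :
    (N * K).det = ∑ g : m → ι, (∏ i, K (g i) i) * (N.submatrix id g).det := by
  classical
  simp only [Matrix.det_apply', Matrix.mul_apply, Finset.prod_univ_sum, Fintype.piFinset_univ,
    Finset.mul_sum, Finset.prod_mul_distrib, Matrix.submatrix_apply, id_eq]
  rw [Finset.sum_comm]
  exact Finset.sum_congr rfl fun g _ => Finset.sum_congr rfl fun σ _ => by ring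

lemma det_mul_mem_maximalMinorIdeal [Fintype ι] (N : Matrix m ι A) (K : Matrix ι m A) :
    (N * K).det ∈ maximalMinorIdeal N := by
  rw [det_mul_eq_sum_prod_mul_det]
  exact Ideal.sum_mem _ fun g _ => Ideal.mul_mem_left _ _ (Ideal.subset_span ⟨g, rfl⟩)

lemma exists_mul_eq_smul_one [Fintype ι] {N : Matrix m ι A} {d : A} (hd : d ∈ maximalMinorIdeal N) :
    ∃ K : Matrix ι m A, N * K = d • 1 := by
  classical
  induction hd using Submodule.span_induction with
  | mem _ h =>
    obtain ⟨g, rfl⟩ := h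
    have hcols : N * (1 : Matrix ι ι A).submatrix id g = N.submatrix id g := by
      simpa only [Matrix.mul_one, Matrix.submatrix_id_id] using
        (Matrix.submatrix_mul N 1 id id g Function.bijective_id).symm
    refine ⟨(1 : Matrix ι ι A).submatrix id g * (N.submatrix id g).adjugate, ?_⟩
    rw [← Matrix.mul_assoc, hcols, Matrix.mul_adjugate]
  | zero => exact ⟨0, by rw [Matrix.mul_zero, zero_smul]⟩
  | add _ _ _ _ h₁ h₂ =>
    obtain ⟨K₁, hK₁⟩ := h₁
    obtain ⟨K₂, hK₂⟩ := h₂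
    exact ⟨K₁ + K₂, by rw [Matrix.mul_add, hK₁, hK₂, add_smul]⟩
  | smul c _ _ h =>
    obtain ⟨K, hK⟩ := h
    exact ⟨c • K, by rw [Matrix.mul_smul, hK, smul_assoc]⟩

theorem surjective_mulVec_iff_maximalMinorIdeal_eq_top [Fintype ι] (N : Matrix m ι A) :
    Function.Surjective N.mulVec ↔ maximalMinorIdeal N = ⊤ := by
  rw [Matrix.mulVec_surjective_iff_exists_right_inverse, Ideal.eq_top_iff_one]
  constructor
  · rintro ⟨K, hK⟩
    simpa only [hK, Matrix.det_one] using det_mul_mem_maximalMinorIdeal N K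
  · intro h
    simpa only [one_smul] using exists_mul_eq_smul_one h

theorem surjective_iff_maximalMinorIdeal_eq_top {V : Type*} [AddCommMonoid V] [Module A V]
    [Finite ι] (v : Module.Basis ι A V) (φ : V →ₗ[A] m → A) :
    Function.Surjective φ ↔
      maximalMinorIdeal (Matrix.of fun i t => φ (v t) i) = ⊤ := by
  have := Fintype.ofFinite ι
  rw [← surjective_mulVec_iff_maximalMinorIdeal_eq_top]
  have hcoord : φ = (Matrix.of fun i t => φ (v t) i).mulVec ∘ v.equivFun := by
    ext x i
    conv_lhs => rw [← v.sum_equivFun x]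
    simp only [map_sum, map_smul, Finset.sum_apply, Pi.smul_apply, smul_eq_mul,
      Function.comp_apply, Matrix.mulVec, dotProduct, Matrix.of_apply, mul_comm]
  exact (iff_of_eq (congrArg Function.Surjective hcoord)).trans
    (v.equivFun.surjective.of_comp_iff _)

end MaximalMinors

section LocallyClosed

lemma range_specMap_subset_compl_zeroLocus_iff {P A : CommRingCat.{u}} (γ : P ⟶ A) (J : Ideal P) :
    Set.range (Spec.map γ) ⊆ (PrimeSpectrum.zeroLocus (J : Set P))ᶜ ↔ J.map γ.hom = ⊤ := by
  rw [← PrimeSpectrum.zeroLocus_empty_iff_eq_top, Ideal.map, PrimeSpectrum.zeroLocus_span,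
    ← PrimeSpectrum.preimage_comap_zeroLocus, Set.preimage_eq_empty_iff]
  exact Set.subset_compl_iff_disjoint_left

lemma exists_comp_specMap_mk_eq_iff {P A : CommRingCat.{u}} (γ : P ⟶ A) (I : Ideal P) :
    (∃ x, x ≫ Spec.map (CommRingCat.ofHom (Ideal.Quotient.mk I)) = Spec.map γ) ↔
      I.map γ.hom = ⊥ := by
  rw [Ideal.map_eq_bot_iff_le_ker]
  constructor
  · rintro ⟨x, hx⟩ f hf
    obtain ⟨δ, rfl⟩ := Spec.map_surjective x
    rw [← Spec.map_comp] at hx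
    rw [RingHom.mem_ker, ← Spec.map_injective hx]
    change δ.hom (Ideal.Quotient.mk I f) = 0
    rw [Ideal.Quotient.eq_zero_iff_mem.2 hf, map_zero]
  · intro hI
    refine ⟨Spec.map (CommRingCat.ofHom (Ideal.Quotient.lift I γ.hom hI)), ?_⟩
    rw [← Spec.map_comp]
    rfl

lemma exists_comp_ι_comp_eq_iff {T Z X : Scheme.{u}} (i : Z ⟶ X) (U : X.Opens) (g : T ⟶ X) :
    (∃ x, x ≫ (i ⁻¹ᵁ U).ι ≫ i = g) ↔ (∃ y, y ≫ i = g) ∧ Set.range g ⊆ U := by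
  constructor
  · rintro ⟨x, rfl⟩
    refine ⟨⟨x ≫ (i ⁻¹ᵁ U).ι, Category.assoc ..⟩, ?_⟩
    rintro _ ⟨t, rfl⟩
    exact (x t).2
  · rintro ⟨⟨y, rfl⟩, hU⟩
    have hy : Set.range y ⊆ Set.range (i ⁻¹ᵁ U).ι := by
      rw [Scheme.Opens.range_ι]
      rintro _ ⟨t, rfl⟩
      exact hU ⟨t, rfl⟩
    exact ⟨IsOpenImmersion.lift _ y hy, by rw [IsOpenImmersion.lift_fac_assoc]⟩

lemma exists_over_comp_eq_iff {𝒞 : Type*} [Category 𝒞] {S : 𝒞} {T C X : Over S} (j : C ⟶ X)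
    (g : T ⟶ X) :
    (∃ x, x ≫ j = g) ↔ ∃ x, x ≫ j.left = g.left := by
  constructor
  · rintro ⟨x, rfl⟩
    exact ⟨x.left, rfl⟩
  · rintro ⟨x, hx⟩
    refine ⟨Over.homMk x ?_, Over.OverMorphism.ext hx⟩
    rw [← Over.w j, reassoc_of% hx, Over.w g]

variable {R : CommRingCat.{u}} (P : CommAlgCat.{u} R) (I J : Ideal P)

/-- The open subset `D(J)` of `Spec P`, the complement of `V(J)`. -/
def complZeroLocus : ((algSpec R).obj (Opposite.op P)).left.Opens :=
  ⟨(PrimeSpectrum.zeroLocus (J : Set P))ᶜ, (PrimeSpectrum.isClosed_zeroLocus _).isOpen_compl⟩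

/-- The immersion of `V(I) ∩ D(J)` into `Spec P`, as a morphism of schemes: the closed immersion
of `V(I) = Spec (P / I)`, restricted to the preimage of `D(J)`. -/
def locallyClosedImmersion :
    (Spec.map (CommRingCat.ofHom (Ideal.Quotient.mk I)) ⁻¹ᵁ complZeroLocus P J).toScheme ⟶
      ((algSpec R).obj (Opposite.op P)).left :=
  Scheme.Opens.ι _ ≫ Spec.map (CommRingCat.ofHom (Ideal.Quotient.mk I))

instance isImmersion_locallyClosedImmersion : IsImmersion (locallyClosedImmersion P I J) := by
  let i := Spec.map (CommRingCat.ofHom (Ideal.Quotient.mk I))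
  have : IsClosedImmersion i :=
    IsClosedImmersion.spec_of_surjective _ Ideal.Quotient.mk_surjective
  exact inferInstanceAs (IsImmersion ((i ⁻¹ᵁ complZeroLocus P J).ι ≫ i))

/-- The locally closed subscheme `V(I) ∩ D(J)` of `Spec P`, over the base ring of `P`. -/
def locallyClosedSubscheme : Over (Spec R) :=
  Over.mk (locallyClosedImmersion P I J ≫ ((algSpec R).obj (Opposite.op P)).hom)

/-- The immersion of `V(I) ∩ D(J)` into `Spec P`, over the base ring of `P`. -/
def locallyClosedSubschemeι : locallyClosedSubscheme P I J ⟶ (algSpec R).obj (Opposite.op P) :=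
  Over.homMk (locallyClosedImmersion P I J)

instance isImmersion_locallyClosedSubschemeι_left :
    IsImmersion (locallyClosedSubschemeι P I J).left :=
  isImmersion_locallyClosedImmersion P I J

instance mono_locallyClosedSubschemeι : Mono (locallyClosedSubschemeι P I J) :=
  Over.mono_of_mono_left _

variable {P} in
theorem exists_comp_locallyClosedSubschemeι_eq_iff {A : CommAlgCat.{u} R} (γ : P ⟶ A) :
    (∃ x, x ≫ locallyClosedSubschemeι P I J = (algSpec R).map γ.op) ↔
      I.map (γ.hom : P →+* A) = ⊥ ∧ J.map (γ.hom : P →+* A) = ⊤ :=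
  (exists_over_comp_eq_iff _ _).trans <| (exists_comp_ι_comp_eq_iff _ _ _).trans <|
    and_congr (exists_comp_specMap_mk_eq_iff (CommRingCat.ofHom (γ.hom : P →+* A)) I)
      (range_specMap_subset_compl_zeroLocus_iff (CommRingCat.ofHom (γ.hom : P →+* A)) J)

end LocallyClosed

section RangeIso

variable {𝒞 : Type*} [Category 𝒞] {F G H : 𝒞 ⥤ Type u}

lemma isIso_lift_of_range_eq {H' : Subfunctor H} (α : F ⟶ H) [Mono α]
    (h : Subfunctor.range α = H') : IsIso (Subfunctor.lift α h.le) := by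
  subst h
  exact inferInstanceAs (IsIso (Subfunctor.toRange α))

lemma exists_iso_of_range_eq (α : F ⟶ H) (β : G ⟶ H) [Mono α] [Mono β]
    (h : Subfunctor.range α = Subfunctor.range β) : ∃ e : F ≅ G, e.hom ≫ β = α := by
  have := isIso_lift_of_range_eq α h
  refine ⟨asIso (Subfunctor.lift α h.le) ≪≫ (asIso (Subfunctor.toRange β)).symm, ?_⟩
  have hβ : inv (Subfunctor.toRange β) ≫ β = (Subfunctor.range β).ι :=
    (IsIso.inv_comp_eq _).2 (Subfunctor.toRange_ι β).symm
  rw [Iso.trans_hom, Iso.symm_hom, asIso_hom, asIso_inv, Category.assoc, hβ, Subfunctor.lift_ι]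

end RangeIso

section MatrixEntries

variable {n R a b : ℕ} {A B : Type u} [CommRing A] [CommRing B]

instance finite_monomials (n : ℕ) (d : ℤ) :
    Finite {m : Fin (n + 1) →₀ ℕ | (m.degree : ℤ) = d} :=
  (Finsupp.finite_of_degree_eq d.toNat).subset fun m hm => by
    simp only [Set.mem_ofPred_eq] at hm ⊢
    omega

/-- The monomial `x_i m` of degree `d`, for a monomial `m` of degree `d - 1`; monomials are given
by their exponents. -/
def mulXMonomial {d : ℤ} (i : Fin (n + 1)) (m : {m : Fin (n + 1) →₀ ℕ | (m.degree : ℤ) = d - 1}) :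
    {m : Fin (n + 1) →₀ ℕ | (m.degree : ℤ) = d} :=
  ⟨Finsupp.single i 1 + m.1, by
    have hm : (m.1.degree : ℤ) = d - 1 := m.2
    simp only [Set.mem_ofPred_eq, map_add, Finsupp.degree_single]
    omega⟩

lemma X_mul_mem_gradedPiece {d : ℤ} (i : Fin (n + 1)) {f : MvPolynomial (Fin (n + 1)) A}
    (hf : f ∈ gradedPiece A n (d - 1)) : MvPolynomial.X i * f ∈ gradedPiece A n d := by
  intro m hm
  change m ∈ (MvPolynomial.X i * f).support at hm
  rw [MvPolynomial.support_X_mul, Finset.mem_map] at hm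
  obtain ⟨m', hm', rfl⟩ := hm
  exact (mulXMonomial i ⟨m', hf hm'⟩).2

/-- The multiplication by `x_i`, as a map `S_{A,d-1} → S_{A,d}`. -/
def mulX (A : Type u) [CommRing A] (n : ℕ) (d : ℤ) (i : Fin (n + 1)) :
    gradedPiece A n (d - 1) →ₗ[A] gradedPiece A n d :=
  (LinearMap.mulLeft A (MvPolynomial.X i)).restrict fun _ hf => X_mul_mem_gradedPiece i hf

lemma mulX_gradedPieceBasis {d : ℤ} (i : Fin (n + 1))
    (m : {m : Fin (n + 1) →₀ ℕ | (m.degree : ℤ) = d - 1}) :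
    mulX A n d i (gradedPieceBasis n A (d - 1) m) = gradedPieceBasis n A d (mulXMonomial i m) := by
  refine Subtype.ext ?_
  change MvPolynomial.X i * (gradedPieceBasis n A (d - 1) m).1 = _
  rw [gradedPieceBasis_coe, gradedPieceBasis_coe, MvPolynomial.X, MvPolynomial.monomial_mul,
    one_mul]
  rfl

/-- The matrix of `ρ` in a tuple of matrices `(ρ, M_0, …, M_n)`. -/
def rhoMatrix (c : Entry n R a b → A) :
    Matrix (Fin a) {m : Fin (n + 1) →₀ ℕ | (m.degree : ℤ) = R} A :=
  Matrix.of fun s m => c (.inl (s, m))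

/-- The matrix of `M_l` in a tuple of matrices `(ρ, M_0, …, M_n)`. -/
def matrixM (c : Entry n R a b → A) (l : Fin (n + 1)) : Matrix (Fin b) (Fin a) A :=
  Matrix.of fun s j => c (.inr (l, s, j))

/-- The matrix of `ΣM` for a tuple of matrices `(ρ, M_0, …, M_n)`: the blocks `M_0, …, M_n` next
to each other. -/
def matrixSumM (c : Entry n R a b → A) : Matrix (Fin b) (Fin (n + 1) × Fin a) A :=
  Matrix.of fun s t => c (.inr (t.1, s, t.2))

/-- The matrix of `M_i ∘ ρ ∘ μ_j` for a tuple of matrices `(ρ, M_0, …, M_n)`, where `μ_j` is the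
multiplication by `x_j`. -/
def pathMatrix (c : Entry n R a b → A) (i j : Fin (n + 1)) :
    Matrix (Fin b) {m : Fin (n + 1) →₀ ℕ | (m.degree : ℤ) = (R : ℤ) - 1} A :=
  matrixM c i * (rhoMatrix c).submatrix id (mulXMonomial j)

/-- The ideal generated by the entries of `M_i ∘ ρ ∘ μ_j - M_j ∘ ρ ∘ μ_i`, for all `i` and `j`. -/
def commIdeal (c : Entry n R a b → A) : Ideal A :=
  Ideal.span (Set.range fun t : (Fin (n + 1) × Fin (n + 1)) ×
    (Fin b × {m : Fin (n + 1) →₀ ℕ | (m.degree : ℤ) = (R : ℤ) - 1}) =>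
      (pathMatrix c t.1.1 t.1.2 - pathMatrix c t.1.2 t.1.1) t.2.1 t.2.2)

/-- The ideal generated by the products of a maximal minor of `ρ` and a maximal minor of `ΣM`. -/
def minorIdeal (c : Entry n R a b → A) : Ideal A :=
  maximalMinorIdeal (rhoMatrix c) * maximalMinorIdeal (matrixSumM c)

lemma map_pathMatrix (f : A →+* B) (c : Entry n R a b → A) (i j : Fin (n + 1)) :
    (pathMatrix c i j).map f = pathMatrix (f ∘ c) i j :=
  Matrix.map_mul

lemma map_commIdeal (f : A →+* B) (c : Entry n R a b → A) :
    (commIdeal c).map f = commIdeal (f ∘ c) := by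
  rw [commIdeal, Ideal.map_span, ← Set.range_comp]
  refine congrArg (fun v => Ideal.span (Set.range v)) (funext fun t => ?_)
  rw [← map_pathMatrix, ← map_pathMatrix]
  exact map_sub f _ _

lemma map_minorIdeal (f : A →+* B) (c : Entry n R a b → A) :
    (minorIdeal c).map f = minorIdeal (f ∘ c) := by
  rw [minorIdeal, Ideal.map_mul, map_maximalMinorIdeal, map_maximalMinorIdeal]
  rfl

lemma commIdeal_eq_bot_iff (c : Entry n R a b → A) :
    commIdeal c = ⊥ ↔ ∀ i j, pathMatrix c i j = pathMatrix c j i := by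
  simp only [commIdeal, Ideal.span_eq_bot, Set.forall_mem_range, Prod.forall, ← Matrix.ext_iff,
    Matrix.sub_apply, sub_eq_zero]

lemma minorIdeal_eq_top_iff (c : Entry n R a b → A) :
    minorIdeal c = ⊤ ↔
      maximalMinorIdeal (rhoMatrix c) = ⊤ ∧ maximalMinorIdeal (matrixSumM c) = ⊤ := by
  constructor
  · exact fun h => ⟨eq_top_mono Ideal.mul_le_left h, eq_top_mono Ideal.mul_le_right h⟩
  · rintro ⟨hρ, hM⟩
    rw [minorIdeal, hρ, hM, Ideal.top_mul]

namespace Rep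

/-- The representation with prescribed matrix entries whose maps `μ_i` are the multiplications by
the variables. -/
def ofEntry (c : Entry n R a b → A) : Rep n R a b A
  | _, _, .mu i => mulX A n R i
  | _, _, .rho => (gradedPieceBasis n A R).constr ℕ fun m => (rhoMatrix c).col m
  | _, _, .M l => (matrixM c l).mulVecLin

lemma rho_gradedPieceBasis (φ : Rep n R a b A)
    (m : {m : Fin (n + 1) →₀ ℕ | (m.degree : ℤ) = R}) :
    φ.rho (gradedPieceBasis n A R m) = (rhoMatrix φ.entry).col m :=
  congrArg φ.rho (Subtype.ext (gradedPieceBasis_coe n A R m))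

lemma M_eq_mulVecLin (φ : Rep n R a b A) (l : Fin (n + 1)) :
    φ.M l = (matrixM φ.entry l).mulVecLin :=
  (Matrix.toLin'_toMatrix' (φ.M l)).symm

lemma sumM_single (φ : Rep n R a b A) (l : Fin (n + 1)) (x : Fin a → A) :
    φ.sumM (Pi.single l x) = φ.M l x := by
  simp only [sumM, LinearMap.sum_apply, LinearMap.comp_apply, LinearMap.proj_apply]
  rw [Finset.sum_eq_single_of_mem l (Finset.mem_univ l) fun i _ hi => by
    rw [Pi.single_eq_of_ne hi, map_zero], Pi.single_eq_same]

lemma mu_ofEntry (c : Entry n R a b → A) : (ofEntry c).mu = mulX A n R :=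
  rfl

lemma entry_ofEntry (c : Entry n R a b → A) : (ofEntry c).entry = c := by
  ext (⟨s, m⟩ | ⟨l, s, j⟩)
  · have hρ := (ofEntry c).rho_gradedPieceBasis m
    exact congrFun (hρ.symm.trans ((gradedPieceBasis n A R).constr_basis ℕ (rhoMatrix c).col m)) s
  · exact congrFun (Matrix.mulVec_single_one (matrixM c l) j) s

lemma ext_entry {φ ψ : Rep n R a b A} (hmu : φ.mu = ψ.mu) (h : φ.entry = ψ.entry) :
    φ = ψ := by
  funext v w e
  change Arrow n v w at e
  cases e with
  | mu i => exact congrFun hmu i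
  | rho =>
    refine (gradedPieceBasis n A R).ext fun m => ?_
    exact (φ.rho_gradedPieceBasis m).trans (h ▸ (ψ.rho_gradedPieceBasis m).symm)
  | M l => exact (φ.M_eq_mulVecLin l).trans (h ▸ (ψ.M_eq_mulVecLin l).symm)

lemma baseChange_rho (f : A →+* B) (φ : Rep n R a b A) (x : gradedPiece A n R) :
    (φ.baseChange f).rho (gradedPieceMap n f _ x) = piMap f a (φ.rho x) :=
  φ.baseChange_apply f (Arrow.rho : (Vertex.two : Vertex n) ⟶ .three) x

lemma baseChange_M (f : A →+* B) (φ : Rep n R a b A) (l : Fin (n + 1)) (x : Fin a → A) :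
    (φ.baseChange f).M l (piMap f a x) = piMap f b (φ.M l x) :=
  φ.baseChange_apply f (Arrow.M l : (Vertex.three : Vertex n) ⟶ .four) x

lemma entry_baseChange (f : A →+* B) (φ : Rep n R a b A) :
    (φ.baseChange f).entry = f ∘ φ.entry := by
  ext (⟨s, m⟩ | ⟨l, s, j⟩)
  · have hρ := φ.baseChange_rho f (gradedPieceBasis n A R m)
    rw [gradedPieceMap_basis, rho_gradedPieceBasis, rho_gradedPieceBasis] at hρ
    exact congrFun hρ s
  · have hM := φ.baseChange_M f l (Pi.basisFun A (Fin a) j)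
    rw [piMap_basis, Pi.basisFun_apply, Pi.basisFun_apply] at hM
    exact congrFun hM s

lemma surjective_rho_iff (φ : Rep n R a b A) :
    Function.Surjective φ.rho ↔ maximalMinorIdeal (rhoMatrix φ.entry) = ⊤ := by
  have hρ : Matrix.of (fun s m => φ.rho (gradedPieceBasis n A R m) s) = rhoMatrix φ.entry := by
    ext s m
    exact congrFun (φ.rho_gradedPieceBasis m) s
  rw [surjective_iff_maximalMinorIdeal_eq_top (gradedPieceBasis n A R), hρ]

lemma surjective_sumM_iff (φ : Rep n R a b A) :
    Function.Surjective φ.sumM ↔ maximalMinorIdeal (matrixSumM φ.entry) = ⊤ := by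
  let v := (Pi.basis fun _ : Fin (n + 1) => Pi.basisFun A (Fin a)).reindex
    (Equiv.sigmaEquivProd _ _)
  have hM : Matrix.of (fun s t => φ.sumM (v t) s) = matrixSumM φ.entry := by
    ext s ⟨l, j⟩
    simp only [v, Matrix.of_apply, Module.Basis.reindex_apply, Equiv.sigmaEquivProd_symm_apply,
      Pi.basis_apply, Pi.basisFun_apply, sumM_single]
    rfl
  rw [surjective_iff_maximalMinorIdeal_eq_top v, hM]

lemma M_rho_mulX_gradedPieceBasis (φ : Rep n R a b A) (i j : Fin (n + 1))
    (m : {m : Fin (n + 1) →₀ ℕ | (m.degree : ℤ) = (R : ℤ) - 1}) :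
    φ.M i (φ.rho (mulX A n R j (gradedPieceBasis n A _ m))) = (pathMatrix φ.entry i j).col m := by
  rw [mulX_gradedPieceBasis, rho_gradedPieceBasis, M_eq_mulVecLin]
  rfl

lemma M_rho_mulX_comm_iff (φ : Rep n R a b A) (i j : Fin (n + 1)) :
    φ.M i ∘ₗ φ.rho ∘ₗ mulX A n R j = φ.M j ∘ₗ φ.rho ∘ₗ mulX A n R i ↔
      pathMatrix φ.entry i j = pathMatrix φ.entry j i := by
  constructor
  · intro h
    ext s m
    have hm := LinearMap.congr_fun h (gradedPieceBasis n A _ m)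
    simp only [LinearMap.comp_apply, M_rho_mulX_gradedPieceBasis] at hm
    exact congrFun hm s
  · intro h
    refine (gradedPieceBasis n A _).ext fun m => ?_
    simp only [LinearMap.comp_apply, M_rho_mulX_gradedPieceBasis, h]

lemma mu_apply_iff (φ : Rep n R a b A) :
    (∀ i (f : gradedPiece A n ((R : ℤ) - 1)), (φ.mu i f).1 = MvPolynomial.X i * f.1) ↔
      φ.mu = mulX A n R := by
  simp only [funext_iff, LinearMap.ext_iff, Subtype.ext_iff]
  rfl

lemma isAdmissible_iff (φ : Rep n R a b A) :
    φ.IsAdmissible ↔ φ.mu = mulX A n R ∧ commIdeal φ.entry = ⊥ ∧ minorIdeal φ.entry = ⊤ := by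
  simp only [commIdeal_eq_bot_iff, minorIdeal_eq_top_iff, ← surjective_rho_iff,
    ← surjective_sumM_iff, ← M_rho_mulX_comm_iff]
  constructor
  · intro h
    have hmu := φ.mu_apply_iff.1 h.mu_apply
    exact ⟨hmu, hmu ▸ h.comm, h.surjective_rho, h.surjective_sumM⟩
  · rintro ⟨hmu, hcomm, hrho, hsumM⟩
    exact ⟨φ.mu_apply_iff.2 hmu, hsumM, hrho, hmu ▸ hcomm⟩

end Rep

end MatrixEntries

section RepresentingScheme

variable {k : Type u} [Field k] {n R a b : ℕ}

/-- The map on `A`-points, natural in the `k`-algebra `A`, induced by a morphism of `k`-schemes. -/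
def pointMap {X Y : Over (Spec (CommRingCat.of k))} (j : X ⟶ Y) :
    pointFunctor k X ⟶ pointFunctor k Y :=
  Functor.whiskerLeft _ (yoneda.map j)

instance mono_pointMap {X Y : Over (Spec (CommRingCat.of k))} (j : X ⟶ Y) [Mono j] :
    Mono (pointMap j) := by
  have (A : CommAlgCat.{u} k) : Mono ((pointMap j).app A) := by
    rw [mono_iff_injective]
    exact fun x y h => (cancel_mono j).1 h
  exact NatTrans.mono_of_mono_app _

lemma matrixPoint_injective (A : CommAlgCat.{u} k) :
    Function.Injective (matrixPoint (n := n) (R := R) (a := a) (b := b) A) := by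
  have : (algSpec (CommRingCat.of k)).Faithful := algSpec.instFaithful
  intro c d h
  have hop := Quiver.Hom.op_inj ((algSpec (CommRingCat.of k)).map_injective h)
  have aeval_eq : (MvPolynomial.aeval c : MvPolynomial (Entry n R a b) k →ₐ[k] A) =
      MvPolynomial.aeval d := congrArg CommAlgCat.Hom.hom hop
  ext t
  rw [← MvPolynomial.aeval_X (R := k) c t, aeval_eq, MvPolynomial.aeval_X]

lemma matrixPoint_surjective (A : CommAlgCat.{u} k) :
    Function.Surjective (matrixPoint (n := n) (R := R) (a := a) (b := b) A) := by
  have : (algSpec (CommRingCat.of k)).Full := algSpec.instFull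
  intro y
  obtain ⟨γ, rfl⟩ := (algSpec (CommRingCat.of k)).map_surjective y
  let g : MvPolynomial (Entry n R a b) k →ₐ[k] A := γ.unop.hom
  exact ⟨fun t => g (MvPolynomial.X t),
    congrArg (fun h => (algSpec (CommRingCat.of k)).map (CommAlgCat.ofHom h).op)
      (MvPolynomial.aeval_unique g).symm⟩

lemma algSpec_map_comp_matrixPoint {A B : CommAlgCat.{u} k} (g : A ⟶ B) (c : Entry n R a b → A) :
    (algSpec (CommRingCat.of k)).map g.op ≫ matrixPoint A c =
      matrixPoint B ((g.hom : A →+* B) ∘ c) := by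
  have aeval_eq : g.hom.comp (MvPolynomial.aeval c) = MvPolynomial.aeval ((g.hom : A →+* B) ∘ c) :=
    MvPolynomial.comp_aeval c g.hom
  exact ((algSpec (CommRingCat.of k)).map_comp _ _).symm.trans
    (congrArg (fun h : MvPolynomial (Entry n R a b) k →ₐ[k] B =>
      (algSpec (CommRingCat.of k)).map (CommAlgCat.ofHom h).op) aeval_eq)

variable (k n R a b)

/-- The ideal of the polynomial equations in the matrix entries that express the relations
`M_i ∘ ρ ∘ μ_j = M_j ∘ ρ ∘ μ_i`. -/
abbrev universalCommIdeal : Ideal (entryAlgebra k n R a b) :=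
  commIdeal (A := entryAlgebra k n R a b) MvPolynomial.X

/-- The ideal of polynomials in the matrix entries whose non-vanishing locus is where `ρ` and `ΣM`
are surjective. -/
abbrev universalMinorIdeal : Ideal (entryAlgebra k n R a b) :=
  minorIdeal (A := entryAlgebra k n R a b) MvPolynomial.X

/-- The scheme `C^p`, for `a = p(R)` and `b = p(R + 1)`. -/
def cpScheme : Over (Spec (CommRingCat.of k)) :=
  locallyClosedSubscheme (R := CommRingCat.of k) (entryAlgebra k n R a b)
    (universalCommIdeal k n R a b) (universalMinorIdeal k n R a b)

/-- The immersion of `C^p` into the affine space of matrices. -/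
def cpSchemeι : cpScheme k n R a b ⟶ matrixSpace k n R a b :=
  locallyClosedSubschemeι (R := CommRingCat.of k) (entryAlgebra k n R a b) _ _

instance isImmersion_cpSchemeι_left : IsImmersion (cpSchemeι k n R a b).left :=
  isImmersion_locallyClosedSubschemeι_left _ _ _

instance mono_cpSchemeι : Mono (cpSchemeι k n R a b) :=
  mono_locallyClosedSubschemeι _ _ _

/-- The map from representations to points of the space of matrices that sends `(μ, ρ, M)` to the
matrix entries of `ρ` and `M`. -/
def entryPoint : CpFunctor k n R a b ⟶ pointFunctor k (matrixSpace k n R a b) where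
  app A := ↾fun φ => matrixPoint A φ.1.entry
  naturality {A B} g := by
    ext φ
    exact (congrArg (matrixPoint B) (φ.1.entry_baseChange (g.hom : A →+* B))).trans
      (algSpec_map_comp_matrixPoint g φ.1.entry).symm

instance mono_entryPoint : Mono (entryPoint k n R a b) := by
  have (A : CommAlgCat.{u} k) : Mono ((entryPoint k n R a b).app A) := by
    rw [mono_iff_injective]
    intro φ ψ h
    have hmu := (φ.1.isAdmissible_iff.1 φ.2).1.trans (ψ.1.isAdmissible_iff.1 ψ.2).1.symm
    exact Subtype.ext (Rep.ext_entry hmu (matrixPoint_injective A h))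
  exact NatTrans.mono_of_mono_app _

variable {k n R a b}

lemma exists_comp_cpSchemeι_eq_matrixPoint_iff (A : CommAlgCat.{u} k) (c : Entry n R a b → A) :
    (∃ x, x ≫ cpSchemeι k n R a b = matrixPoint A c) ↔ commIdeal c = ⊥ ∧ minorIdeal c = ⊤ := by
  let γ : entryAlgebra k n R a b ⟶ A := CommAlgCat.ofHom (MvPolynomial.aeval c)
  have hγ : (γ.hom : entryAlgebra k n R a b →+* A) ∘ MvPolynomial.X = c :=
    funext (MvPolynomial.aeval_X c)
  rw [← hγ, ← map_commIdeal, ← map_minorIdeal, hγ]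
  exact exists_comp_locallyClosedSubschemeι_eq_iff (R := CommRingCat.of k) _ _ γ

lemma exists_entryPoint_eq_matrixPoint_iff (A : CommAlgCat.{u} k) (c : Entry n R a b → A) :
    (∃ φ, (entryPoint k n R a b).app A φ = matrixPoint A c) ↔
      commIdeal c = ⊥ ∧ minorIdeal c = ⊤ := by
  constructor
  · rintro ⟨φ, hφ⟩
    obtain rfl := matrixPoint_injective A hφ
    exact (φ.1.isAdmissible_iff.1 φ.2).2
  · intro hc
    refine ⟨⟨Rep.ofEntry c, (Rep.isAdmissible_iff _).2 ⟨Rep.mu_ofEntry c, ?_⟩⟩, ?_⟩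
    · rwa [Rep.entry_ofEntry]
    · exact congrArg (matrixPoint A) (Rep.entry_ofEntry c)

variable (k n R a b)

lemma range_pointMap_cpSchemeι :
    Subfunctor.range (pointMap (cpSchemeι k n R a b)) =
      Subfunctor.range (entryPoint k n R a b) := by
  ext A y
  obtain ⟨c, rfl⟩ := matrixPoint_surjective A y
  exact (exists_comp_cpSchemeι_eq_matrixPoint_iff A c).trans
    (exists_entryPoint_eq_matrixPoint_iff A c).symm

theorem exists_iso_forall_comp_cpSchemeι_eq :
    ∃ e : pointFunctor k (cpScheme k n R a b) ≅ CpFunctor k n R a b,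
      ∀ (A : CommAlgCat.{u} k)
        (x : (algSpec (CommRingCat.of k)).obj (Opposite.op A) ⟶ cpScheme k n R a b),
        x ≫ cpSchemeι k n R a b = matrixPoint A (e.hom.app A x).1.entry := by
  obtain ⟨e, he⟩ := exists_iso_of_range_eq _ _ (range_pointMap_cpSchemeι k n R a b)
  exact ⟨e, fun A x => (congrArg (fun β => β.app A x) he).symm⟩

end RepresentingScheme

section Dimension

lemma card_monomials (n d : ℕ) :
    Nat.card {m : Fin (n + 1) →₀ ℕ | (m.degree : ℤ) = d} = (d + n).choose d := by
  have h : {m : Fin (n + 1) →₀ ℕ | (m.degree : ℤ) = d} =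
      ((Finset.univ : Finset (Fin (n + 1))).finsuppAntidiag d : Set (Fin (n + 1) →₀ ℕ)) := by
    ext m
    rw [Set.mem_ofPred_eq, Nat.cast_inj]
    simp [Finsupp.degree_eq_sum]
  rw [h, Nat.card_coe_set_eq, Set.ncard_coe_finset, Finset.card_finsuppAntidiag_nat_eq_choose,
    Finset.card_univ, Fintype.card_fin]
  congr 1
  omega

variable (A : Type u) [CommRing A]

lemma finrank_gradedPiece [Nontrivial A] (n d : ℕ) :
    Module.finrank A (gradedPiece A n d) = (d + n).choose d := by
  rw [Module.finrank_eq_nat_card_basis (gradedPieceBasis n A d), card_monomials]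

lemma gradedPiece_eq_bot_of_neg (n : ℕ) {d : ℤ} (hd : d < 0) : gradedPiece A n d = ⊥ := by
  have hempty : {m : Fin (n + 1) →₀ ℕ | (m.degree : ℤ) = d} = ∅ :=
    Set.eq_empty_of_forall_notMem fun m hm => by
      rw [Set.mem_ofPred_eq] at hm
      omega
  rw [gradedPiece, hempty, MvPolynomial.restrictSupport_eq_span, Set.image_empty,
    Submodule.span_empty]

lemma finrank_vertexSpace [Nontrivial A] (n R a b : ℕ) (v : Vertex n) :
    Module.finrank A (vertexSpace n R a b A v) = dimVector n R a b v := by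
  cases v with
  | one =>
    change Module.finrank A (gradedPiece A n ((R : ℤ) - 1)) = _
    cases R with
    | zero =>
      rw [gradedPiece_eq_bot_of_neg A n (by simp)]
      exact finrank_bot A _
    | succ R =>
      rw [Nat.cast_succ, add_sub_cancel_right]
      exact finrank_gradedPiece A n R
  | two => exact finrank_gradedPiece A n R
  | three => exact Module.finrank_fin_fun A
  | four => exact Module.finrank_fin_fun A

end Dimension

lemma Rep.toQuiverRep_injective {n R a b : ℕ} {A : Type u} [CommRing A] :
    Function.Injective (Rep.toQuiverRep : Rep n R a b A → QuiverRep A n) := by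
  intro φ ψ h
  injection h with _ hmap
  funext v w e
  exact congrArg ModuleCat.Hom.hom (congrFun (congrFun (congrFun hmap v) w) e)

lemma bijOn_toQuiverRep {n R a b : ℕ} {A : Type u} [CommRing A] :
    Set.BijOn (fun φ : CpPoint n R a b A => φ.1.toQuiverRep) Set.univ
      {F | ∃ φ : Rep n R a b A, φ.IsAdmissible ∧ φ.toQuiverRep = F} := by
  refine ⟨fun φ _ => ⟨φ.1, φ.2, rfl⟩,
    (Rep.toQuiverRep_injective.comp Subtype.val_injective).injOn, ?_⟩
  rintro _ ⟨φ, hφ, rfl⟩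
  exact ⟨⟨φ, hφ⟩, trivial, rfl⟩

end

end HilbertQuiver

theorem mainTheorem10_general (k : Type u) [Field k] (n R a b : ℕ) :
    ∃ (C : Over (Spec (CommRingCat.of k)))
      (e : HilbertQuiver.pointFunctor k C ≅ HilbertQuiver.CpFunctor k n R a b),
      (∃ j : C ⟶ HilbertQuiver.matrixSpace k n R a b, IsImmersion j.left ∧
        ∀ (A : CommAlgCat.{u} k)
          (x : (algSpec (CommRingCat.of k)).obj (Opposite.op A) ⟶ C),
          x ≫ j = HilbertQuiver.matrixPoint A (e.hom.app A x).1.entry) ∧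
      Set.BijOn
        (fun x : (algSpec (CommRingCat.of k)).obj (Opposite.op (CommAlgCat.of k k)) ⟶ C =>
          (e.hom.app (CommAlgCat.of k k) x).1.toQuiverRep)
        Set.univ
        {F : HilbertQuiver.QuiverRep k n |
          ∃ φ : HilbertQuiver.Rep n R a b k, φ.IsAdmissible ∧ φ.toQuiverRep = F} ∧
      ∀ (x : (algSpec (CommRingCat.of k)).obj (Opposite.op (CommAlgCat.of k k)) ⟶ C)
        (v : HilbertQuiver.Vertex n),
        Module.finrank k ((e.hom.app (CommAlgCat.of k k) x).1.toQuiverRep.obj v) =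
          HilbertQuiver.dimVector n R a b v := by
  obtain ⟨e, he⟩ := HilbertQuiver.exists_iso_forall_comp_cpSchemeι_eq k n R a b
  refine ⟨HilbertQuiver.cpScheme k n R a b, e,
    ⟨HilbertQuiver.cpSchemeι k n R a b, inferInstance, he⟩, ?_,
    fun _ v => HilbertQuiver.finrank_vertexSpace k n R a b v⟩
  exact HilbertQuiver.bijOn_toQuiverRep.comp
    (Set.bijOn_univ.2 (e.app (CommAlgCat.of k k)).toEquiv.bijective)

theorem mainTheorem10 (k : Type u) [Field k] (n : ℕ) (p : Polynomial ℚ)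
    (hp : HilbertQuiver.IsHilbertPolynomial k n p)
    (r : ℕ) (hr : HilbertQuiver.IsGotzmannNumber p r) (R : ℕ) (hR : r ≤ R)
    (a b : ℕ) (ha : (a : ℚ) = p.eval (R : ℚ)) (hb : (b : ℚ) = p.eval ((R : ℚ) + 1)) :
    ∃ (C : Over (Spec (CommRingCat.of k)))
      (e : HilbertQuiver.pointFunctor k C ≅ HilbertQuiver.CpFunctor k n R a b),
      (∃ j : C ⟶ HilbertQuiver.matrixSpace k n R a b, IsImmersion j.left ∧
        ∀ (A : CommAlgCat.{u} k)
          (x : (algSpec (CommRingCat.of k)).obj (Opposite.op A) ⟶ C),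
          x ≫ j = HilbertQuiver.matrixPoint A (e.hom.app A x).1.entry) ∧
      Set.BijOn
        (fun x : (algSpec (CommRingCat.of k)).obj (Opposite.op (CommAlgCat.of k k)) ⟶ C =>
          (e.hom.app (CommAlgCat.of k k) x).1.toQuiverRep)
        Set.univ
        {F : HilbertQuiver.QuiverRep k n |
          ∃ φ : HilbertQuiver.Rep n R a b k, φ.IsAdmissible ∧ φ.toQuiverRep = F} ∧
      ∀ (x : (algSpec (CommRingCat.of k)).obj (Opposite.op (CommAlgCat.of k k)) ⟶ C)
        (v : HilbertQuiver.Vertex n),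
        Module.finrank k ((e.hom.app (CommAlgCat.of k k) x).1.toQuiverRep.obj v) =
          HilbertQuiver.dimVector n R a b v :=
  mainTheorem10_general k n R a b
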